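/- Proposition 4.1. On $M^3=\mathbb R^3$ with coordinates $(x_1,x_2,x_3)$ let $$g = dx_1^2+dx_2^2+(x_1\,dx_2+dx_3)^2,\qquad X=-x_1\partial_1-x_2\partial_2-2x_3\partial_3 ;$$ this is the nongradient $\mathrm{nil}^3$ expanding Ricci soliton $(M^3,g,X,3)$ of Baird–Danielo, $2\,\mathrm{Rc}+\mathcal L_Xg+3g=0$. Let $$Lh=\Delta_\ell h-\mathcal L_Xh-3h,\qquad \Delta_\ell h_{ij}=\Delta h_{ij}+2R_{ipqj}h^{pq}-R_i^kh_{kj}-R_j^kh_{ik},$$ be the linearization at $g$ (after the DeTurck trick) of the modified Ricci flow $\partial_\tau g=-2\,\mathrm{Rc}(g)-\mathcal L_Xg-3g$; here $\mathcal L_X$ is the Lie derivative, $\Delta=g^{kl}\nabla_k\nabla_l$, and the sign of the curvature tensor is such that $R_{jk}=g^{il}R_{ijkl}$. Then every smooth compactly supported symmetric $2$-tensor field $h$ satisfies $$\int\langle Lh,h\rangle\,d\mu\le-\|\nabla h\|^2-\tfrac12\|h\|^2,$$ where $d\mu$ is the Riemannian volume measure of $g$ and norms are $L^2(d\mu)$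 norms. Hence $L$ is strictly linearly stable with $\omega=\tfrac12>0$: smooth compactly supported symmetric $2$-tensor fields are dense in the space of symmetric $L^2$ tensor fields, and for every $u$ in the domain of the $L^2$-closure $\bar L$ of $L$ (i.e. whenever there are such fields $h_m$ with $h_m\to u$ and $Lh_m\to f=:\bar Lu$ in $L^2$) one has $\int\langle\bar Lu,u\rangle\,d\mu\le-\omega\|u\|^2$. -/

import Mathlib

open MeasureTheory Filter Topology
open scoped ContDiff

noncomputable section

/-! Riemannian geometry on `ℝⁿ` in its global coordinates. Tensors are given by their components
with respect to the coordinate vector fields; repeated indices are summed. -/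

/-- Covariant 2-tensor fields on `ℝⁿ`, `h x i j = h_ij(x)`. -/
abbrev TwoTensor (n : ℕ) := (Fin n → ℝ) → Matrix (Fin n) (Fin n) ℝ

/-- Covariant 3-tensor fields on `ℝⁿ`, `T x k i j = T_kij(x)`. -/
abbrev ThreeTensor (n : ℕ) := (Fin n → ℝ) → Fin n → Fin n → Fin n → ℝ

/-- The partial derivative `∂_i f`. -/
def pderiv {n : ℕ} (i : Fin n) (f : (Fin n → ℝ) → ℝ) (x : Fin n → ℝ) : ℝ :=
  fderiv ℝ f x (Pi.single i 1)

/-- The components `g^ij` of the inverse metric. -/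
def invMetric {n : ℕ} (g : TwoTensor n) : TwoTensor n := fun x => (g x)⁻¹

/-- The Christoffel symbols `Γ^k_ij = ½ g^kl (∂_i g_jl + ∂_j g_il - ∂_l g_ij)` of the Levi-Civita
connection. -/
def christoffel {n : ℕ} (g : TwoTensor n) (k i j : Fin n) (x : Fin n → ℝ) : ℝ :=
  ∑ l, 1 / 2 * invMetric g x k l *
    (pderiv i (fun y => g y j l) x + pderiv j (fun y => g y i l) x
      - pderiv l (fun y => g y i j) x)

/-- The covariant derivative of a 2-tensor field, `(∇h)_kij = ∇_k h_ij`. -/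
def covDeriv {n : ℕ} (g h : TwoTensor n) : ThreeTensor n := fun x k i j =>
  pderiv k (fun y => h y i j) x
    - ∑ m, (christoffel g m k i x * h x m j + christoffel g m k j x * h x i m)

/-- The covariant derivative of a 3-tensor field, `∇_l T_kij`. -/
def covDeriv₃ {n : ℕ} (g : TwoTensor n) (T : ThreeTensor n) (x : Fin n → ℝ)
    (l k i j : Fin n) : ℝ :=
  pderiv l (fun y => T y k i j) x
    - ∑ m, (christoffel g m l k x * T x m i j + christoffel g m l i x * T x k m j
        + christoffel g m l j x * T x k i m)

/-- The rough Laplacian `Δh_ij = g^kl ∇_l ∇_k h_ij`. -/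
def roughLaplacian {n : ℕ} (g h : TwoTensor n) : TwoTensor n := fun x i j =>
  ∑ k, ∑ l, invMetric g x k l * covDeriv₃ g (covDeriv g h) x l k i j

/-- The components `R_ijk^l` of the curvature: `R(∂_i, ∂_j)∂_k = R_ijk^l ∂_l` with
`R(V, W) = ∇_V ∇_W - ∇_W ∇_V - ∇_[V,W]`. -/
def curvatureUp {n : ℕ} (g : TwoTensor n) (x : Fin n → ℝ) (i j k l : Fin n) : ℝ :=
  pderiv i (christoffel g l j k) x - pderiv j (christoffel g l i k) x
    + ∑ m, (christoffel g m j k x * christoffel g l i m x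
        - christoffel g m i k x * christoffel g l j m x)

/-- The Riemann tensor `R_ijkl = ⟨R(∂_i, ∂_j)∂_k, ∂_l⟩`; round spheres have `R_ijji > 0`. -/
def curvature {n : ℕ} (g : TwoTensor n) (x : Fin n → ℝ) (i j k l : Fin n) : ℝ :=
  ∑ m, g x l m * curvatureUp g x i j k m

/-- The Ricci tensor `R_jk = g^il R_ijkl`. -/
def ricci {n : ℕ} (g : TwoTensor n) : TwoTensor n := fun x j k =>
  ∑ i, ∑ l, invMetric g x i l * curvature g x i j k l

/-- The Lichnerowicz Laplacian
`Δ_ℓ h_ij = Δh_ij + 2 R_ipqj h^pq - R_i^k h_kj - R_j^k h_ik`. -/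
def lichnerowicz {n : ℕ} (g h : TwoTensor n) : TwoTensor n := fun x i j =>
  roughLaplacian g h x i j
    + 2 * ∑ p, ∑ q, curvature g x i p q j *
        (∑ a, ∑ b, invMetric g x p a * invMetric g x q b * h x a b)
    - ∑ k, (∑ l, ricci g x i l * invMetric g x l k) * h x k j
    - ∑ k, (∑ l, ricci g x j l * invMetric g x l k) * h x i k

/-- The Lie derivative
`(ℒ_X h)_ij = X^k ∂_k h_ij + (∂_i X^k) h_kj + (∂_j X^k) h_ik` of a 2-tensor field. -/
def lieDeriv {n : ℕ} (X : (Fin n → ℝ) → Fin n → ℝ) (h : TwoTensor n) : TwoTensor n :=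
  fun x i j =>
    ∑ k, (X x k * pderiv k (fun y => h y i j) x
      + pderiv i (fun y => X y k) x * h x k j + pderiv j (fun y => X y k) x * h x i k)

/-- The linearization `L h = Δ_ℓ h - ℒ_X h - α h` of the modified Ricci flow
`∂g/∂τ = -2 Rc(g) - ℒ_X g - α g` at `g` (after the DeTurck trick). -/
def linearizedFlow {n : ℕ} (g : TwoTensor n) (X : (Fin n → ℝ) → Fin n → ℝ) (α : ℝ)
    (h : TwoTensor n) : TwoTensor n := fun x i j =>
  lichnerowicz g h x i j - lieDeriv X h x i j - α * h x i j

/-- The pointwise inner product `⟨h, k⟩ = g^ip g^jq h_ij k_pq` of 2-tensor fields. -/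
def inner₂ {n : ℕ} (g h k : TwoTensor n) (x : Fin n → ℝ) : ℝ :=
  ∑ i, ∑ j, ∑ p, ∑ q, invMetric g x i p * invMetric g x j q * h x i j * k x p q

/-- The pointwise inner product `⟨S, T⟩ = g^kl g^ip g^jq S_kij T_lpq` of 3-tensor fields. -/
def inner₃ {n : ℕ} (g : TwoTensor n) (S T : ThreeTensor n) (x : Fin n → ℝ) : ℝ :=
  ∑ k, ∑ l, ∑ i, ∑ j, ∑ p, ∑ q,
    invMetric g x k l * invMetric g x i p * invMetric g x j q * S x k i j * T x l p q

/-- The Riemannian volume measure `dμ = √(det g) dx`. -/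
def riemVolume {n : ℕ} (g : TwoTensor n) : Measure (Fin n → ℝ) :=
  volume.withDensity fun x => ENNReal.ofReal (Real.sqrt (g x).det)

/-- Smooth, compactly supported, symmetric 2-tensor fields. -/
structure IsTestTensor {n : ℕ} (h : TwoTensor n) : Prop where
  smooth : ∀ i j, ContDiff ℝ ∞ fun x => h x i j
  compactSupport : HasCompactSupport h
  symm : ∀ x i j, h x i j = h x j i

/-- Square-integrable symmetric 2-tensor fields. -/
structure IsL2Tensor {n : ℕ} (g u : TwoTensor n) : Prop where
  measurable : ∀ i j, AEStronglyMeasurable (fun x => u x i j) (riemVolume g)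
  integrable : Integrable (inner₂ g u u) (riemVolume g)
  symm : ∀ᵐ x ∂(riemVolume g), ∀ i j, u x i j = u x j i

/-- `‖h‖² = ∫ |h|² dμ`. -/
def normSq {n : ℕ} (g h : TwoTensor n) : ℝ := ∫ x, inner₂ g h h x ∂(riemVolume g)

/-- `(u, f)` lies in the `L²`-closure of the graph of the operator `L` on smooth compactly
supported symmetric 2-tensor fields: `u` is in the domain of the closure of `L`, with value `f`. -/
def InClosureGraph {n : ℕ} (g : TwoTensor n) (L : TwoTensor n → TwoTensor n)
    (u f : TwoTensor n) : Prop :=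
  IsL2Tensor g u ∧ IsL2Tensor g f ∧
    ∃ h : ℕ → TwoTensor n, (∀ m, IsTestTensor (h m)) ∧
      Tendsto (fun m => normSq g (h m - u)) atTop (𝓝 0) ∧
      Tendsto (fun m => normSq g (L (h m) - f)) atTop (𝓝 0)

/-- The operator `L`, defined a priori on smooth compactly supported symmetric 2-tensor fields, is
strictly linearly stable with constant `c`: `c > 0`, `L` is densely defined in `L²`, and
`(L u, u) ≤ -c ‖u‖²` for every `u` in the domain of the `L²`-closure of `L`. -/
def StrictlyLinearlyStable {n : ℕ} (g : TwoTensor n) (L : TwoTensor n → TwoTensor n)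
    (c : ℝ) : Prop :=
  0 < c ∧
  (∀ u, IsL2Tensor g u → ∀ ε > 0, ∃ h, IsTestTensor h ∧ normSq g (h - u) < ε) ∧
  (∀ u f, InClosureGraph g L u f →
    ∫ x, inner₂ g f u x ∂(riemVolume g) ≤ -c * normSq g u)

/-- The coframe `dx₁, dx₂, x₁ dx₂ + dx₃` on `ℝ³` (row `a` holds the components of the `a`-th
1-form; the coordinates `x₁, x₂, x₃` are `x 0, x 1, x 2`). It is left-invariant on the Heisenberg
group. -/
def nilCoframe (x : Fin 3 → ℝ) : Matrix (Fin 3) (Fin 3) ℝ :=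
  !![1, 0, 0; 0, 1, 0; 0, x 0, 1]

/-- The nil³ soliton metric `g = dx₁² + dx₂² + (x₁ dx₂ + dx₃)²`. -/
def nilMetric : TwoTensor 3 := fun x i j => ∑ a, nilCoframe x a i * nilCoframe x a j

/-- The nil³ soliton vector field `X = -x₁ ∂₁ - x₂ ∂₂ - 2 x₃ ∂₃`. -/
def nilField : (Fin 3 → ℝ) → Fin 3 → ℝ := fun x => ![-x 0, -x 1, -2 * x 2]

/-- The linearization `L = Δ_ℓ - ℒ_X - 3` at the nil³ soliton `(ℝ³, g, X, 3)`. -/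
def nilL : TwoTensor 3 → TwoTensor 3 := linearizedFlow nilMetric nilField 3

end

/-! The forms `dx₁, dx₂, x₁ dx₂ + dx₃` are orthonormal and left-invariant on the Heisenberg group,
so in the dual frame `e₀, e₁, e₂` the connection coefficients and the curvature are constants. Write
`H_ab = h(e_a, e_b)`. The Ricci tensor is `diag(-1/2, -1/2, 1/2)`, and the flow of `X` dilates the
coframe with weights `-1, -1, -2`; hence the Ricci terms of the Lichnerowicz Laplacian, the
zero-order part of the Lie derivative and `-3 h` cancel, which is the soliton equation, and
`(L h)_ab = (Δh)_ab + 2 R_acdb H_cd - X(H_ab)` (`toFrame_nilL`).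

Pair this with `h` and integrate. The Laplacian gives `-‖∇h‖²` up to the divergence of `⟨∇h, h⟩`
(`frameLaplacian_mul_self`). As `div X = -4`, the transport term gives `-2 ‖h‖²` up to a divergence
(`nilField_mul_self`). The curvature term is at most `3/2 |h|²` pointwise (`nilCurv_le`).
Divergences of compactly supported fields integrate to zero, and the sum is the bound
(`integral_inner_nilL_le`).

The metric has determinant one, so `L²` tensor fields are those with frame components in `L²` of
Lebesgue measure. Density is the density of test functions in each component
(`exists_isTestTensor_normSq_lt`), and the bound passes to the closure because the `L²` pairing is
continuous (`HasL2Components.tendsto_integral_inner₂`). -/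

noncomputable section

/-! ### Partial derivatives -/

section PartialDerivatives

variable {n : ℕ} {f g : (Fin n → ℝ) → ℝ} {x : Fin n → ℝ}

lemma pderiv_sub (i : Fin n) (hf : DifferentiableAt ℝ f x) (hg : DifferentiableAt ℝ g x) :
    pderiv i (fun y => f y - g y) x = pderiv i f x - pderiv i g x := by
  simp [pderiv, fderiv_fun_sub hf hg]

lemma pderiv_mul (i : Fin n) (hf : DifferentiableAt ℝ f x) (hg : DifferentiableAt ℝ g x) :
    pderiv i (fun y => f y * g y) x = pderiv i f x * g x + f x * pderiv i g x := by
  simp [pderiv, fderiv_fun_mul hf hg]; ring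

lemma pderiv_sum {ι : Type*} (s : Finset ι) (i : Fin n) {F : ι → (Fin n → ℝ) → ℝ}
    (hF : ∀ a ∈ s, DifferentiableAt ℝ (F a) x) :
    pderiv i (fun y => ∑ a ∈ s, F a y) x = ∑ a ∈ s, pderiv i (F a) x := by
  simp [pderiv, fderiv_fun_sum hF]

@[simp]
lemma pderiv_coord (i j : Fin n) : pderiv i (fun y => y j) x = if i = j then 1 else 0 := by
  have : (fun y : Fin n → ℝ => y j) = ContinuousLinearMap.proj (R := ℝ) (φ := fun _ => ℝ) j := rfl
  simp only [pderiv, this, ContinuousLinearMap.fderiv]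
  simp [Pi.single_apply, eq_comm]

lemma pderiv_comp_coord (i j : Fin n) {p : ℝ → ℝ} {p' : ℝ} (hp : HasDerivAt p p' (x j)) :
    pderiv i (fun y => p (y j)) x = if i = j then p' else 0 := by
  have h1 : HasFDerivAt (fun y : Fin n → ℝ => y j)
      (ContinuousLinearMap.proj (R := ℝ) (φ := fun _ => ℝ) j) x :=
    (ContinuousLinearMap.proj (R := ℝ) (φ := fun _ => ℝ) j).hasFDerivAt
  have := hp.comp_hasFDerivAt x h1
  rw [pderiv, show (fun y : Fin n → ℝ => p (y j)) = p ∘ fun y => y j from rfl, this.fderiv]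
  simp [Pi.single_apply, eq_comm]

lemma contDiff_pderiv (i : Fin n) (hf : ContDiff ℝ ∞ f) : ContDiff ℝ ∞ (pderiv i f) :=
  (hf.fderiv_right (m := ∞) (by simp)).clm_apply contDiff_const

lemma hasCompactSupport_pderiv (i : Fin n) (hf : HasCompactSupport f) :
    HasCompactSupport (pderiv i f) :=
  hf.fderiv_apply (𝕜 := ℝ) _

lemma integral_pderiv (i : Fin n) (hf : ContDiff ℝ ∞ f) (hc : HasCompactSupport f) :
    ∫ x, pderiv i f x = 0 := by
  have h1 : Integrable (fun x => (fun _ => (1 : ℝ)) x * fderiv ℝ f x (Pi.single i 1)) := by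
    simp only [one_mul]
    exact (contDiff_pderiv i hf).continuous.integrable_of_hasCompactSupport
      (hasCompactSupport_pderiv i hc)
  have h2 : Integrable (fun x => (fun _ => (1 : ℝ)) x * f x) := by
    simpa using hf.continuous.integrable_of_hasCompactSupport hc
  have h := integral_mul_fderiv_eq_neg_fderiv_mul_of_integrable (v := Pi.single i 1)
    (by simp) h1 h2 (by simp) (fun x _ => hf.differentiable (by simp) x)
  simpa [pderiv] using h

end PartialDerivatives

/-! ### The nil metric in coordinates and in its left-invariant orthonormal frame -/

/-- The orthonormal frame `e₀ = ∂₁, e₁ = ∂₂ - x₁ ∂₃, e₂ = ∂₃` dual to `nilCoframe`: column `a`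
holds the components of `e_a`. -/
def nilFrame (x : Fin 3 → ℝ) : Matrix (Fin 3) (Fin 3) ℝ :=
  !![1, 0, 0; 0, 1, 0; 0, -x 0, 1]

lemma invMetric_nil (x : Fin 3 → ℝ) (i j : Fin 3) :
    invMetric nilMetric x i j = ∑ a, nilFrame x i a * nilFrame x j a := by
  have : invMetric nilMetric x = nilFrame x * (nilFrame x).transpose := by
    refine Matrix.inv_eq_right_inv ?_
    ext i j
    simp only [nilMetric, Matrix.mul_apply, Matrix.transpose_apply, Fin.sum_univ_three]
    fin_cases i <;> fin_cases j <;> (simp [nilCoframe, nilFrame]; try ring)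
  simp [this, Matrix.mul_apply]

lemma det_nilMetric (x : Fin 3 → ℝ) : (nilMetric x).det = 1 := by
  simp [Matrix.det_fin_three, nilMetric, nilCoframe, Fin.sum_univ_three]

lemma riemVolume_nil : riemVolume nilMetric = volume := by
  simp [riemVolume, det_nilMetric]

/-- Closed form of the Christoffel symbols `Γ^k_ij` of the nil metric in the coordinates, as
functions of `t = x₁`. -/
def nilChristoffel (k i j : Fin 3) (t : ℝ) : ℝ :=
  (![!![0, 0, 0; 0, -t, -1 / 2; 0, -1 / 2, 0],
     !![0, t / 2, 1 / 2; t / 2, 0, 0; 1 / 2, 0, 0],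
     !![0, (1 - t ^ 2) / 2, -t / 2; (1 - t ^ 2) / 2, 0, 0; -t / 2, 0, 0]] k) i j

/-- The derivatives of `nilChristoffel` in `t`. -/
def nilChristoffelDeriv (k i j : Fin 3) (t : ℝ) : ℝ :=
  (![!![0, 0, 0; 0, -1, 0; 0, 0, 0],
     !![0, 1 / 2, 0; 1 / 2, 0, 0; 0, 0, 0],
     !![0, -t, -1 / 2; -t, 0, 0; -1 / 2, 0, 0]] k) i j

lemma hasDerivAt_nilChristoffel (k i j : Fin 3) (t : ℝ) :
    HasDerivAt (nilChristoffel k i j) (nilChristoffelDeriv k i j t) t := by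
  have h0 (c : ℝ) : HasDerivAt (fun _ : ℝ => c) 0 t := hasDerivAt_const t c
  have h1 : HasDerivAt (fun s : ℝ => -s) (-1) t := (hasDerivAt_id t).neg
  have h2 : HasDerivAt (fun s : ℝ => s / 2) (1 / 2) t := (hasDerivAt_id t).div_const 2
  have h3 : HasDerivAt (fun s : ℝ => -s / 2) (-1 / 2) t := h1.div_const 2
  have h4 : HasDerivAt (fun s : ℝ => (1 - s ^ 2) / 2) (-t) t := by
    convert! ((hasDerivAt_pow 2 t).const_sub 1).div_const 2 using 1
    simp; ring
  fin_cases k <;> fin_cases i <;> fin_cases j <;>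
    first | exact h0 _ | exact h1 | exact h2 | exact h3 | exact h4

/-- The derivative `∂g_ij/∂x₁`; the other partial derivatives of the metric vanish. -/
lemma pderiv_nilMetric (k i j : Fin 3) (x : Fin 3 → ℝ) :
    pderiv k (fun y => nilMetric y i j) x =
      if k = 0 then !![0, 0, 0; 0, 2 * x 0, 1; 0, 1, 0] i j else 0 := by
  have h0 (c : ℝ) : HasDerivAt (fun _ : ℝ => c) 0 (x 0) := hasDerivAt_const _ c
  have h1 : HasDerivAt (fun s : ℝ => s) 1 (x 0) := hasDerivAt_id _
  have h2 : HasDerivAt (fun s : ℝ => 1 + s * s) (2 * x 0) (x 0) := by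
    convert! ((hasDerivAt_id (x 0)).mul (hasDerivAt_id (x 0))).const_add 1 using 1
    simp; ring
  have key : HasDerivAt (fun t : ℝ => !![1, 0, 0; 0, 1 + t * t, t; 0, t, 1] i j)
      (!![0, 0, 0; 0, 2 * x 0, 1; 0, 1, 0] i j) (x 0) := by
    fin_cases i <;> fin_cases j <;> first | exact h0 _ | exact h1 | exact h2
  rw [← pderiv_comp_coord k 0 key]
  congr 1
  ext y
  fin_cases i <;> fin_cases j <;> simp [nilMetric, nilCoframe, Fin.sum_univ_three]

lemma christoffel_nil (k i j : Fin 3) :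
    christoffel nilMetric k i j = fun x => nilChristoffel k i j (x 0) := by
  ext x
  simp only [christoffel, pderiv_nilMetric, invMetric_nil, Fin.sum_univ_three]
  fin_cases k <;> fin_cases i <;> fin_cases j <;>
    simp [nilFrame, nilChristoffel] <;> try ring

lemma pderiv_christoffel_nil (l k i j : Fin 3) (x : Fin 3 → ℝ) :
    pderiv l (christoffel nilMetric k i j) x =
      if l = 0 then nilChristoffelDeriv k i j (x 0) else 0 := by
  rw [christoffel_nil, pderiv_comp_coord l 0 (hasDerivAt_nilChristoffel k i j (x 0))]

/-- The connection coefficients `⟨∇_{e_c} e_a, e_d⟩` of the frame; they are constant because the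
frame is left-invariant, and skew in `a, d` because it is orthonormal. -/
def nilConn (c a d : Fin 3) : ℝ :=
  (![!![0, 0, 0; 0, 0, -1 / 2; 0, 1 / 2, 0],
     !![0, 0, 1 / 2; 0, 0, 0; -1 / 2, 0, 0],
     !![0, 1 / 2, 0; -1 / 2, 0, 0; 0, 0, 0]] c) a d

/-- The value `v(e_a)` at `x` of the covector with coordinate components `v`. -/
def frameEval (x : Fin 3 → ℝ) (a : Fin 3) (v : Fin 3 → ℝ) : ℝ := ∑ i, nilFrame x i a * v i

section FrameEval

variable (x : Fin 3 → ℝ) (v : Fin 3 → ℝ)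

lemma frameEval_zero : frameEval x 0 v = v 0 := by
  simp [frameEval, nilFrame, Fin.sum_univ_three]

lemma frameEval_one : frameEval x 1 v = v 1 - x 0 * v 2 := by
  simp [frameEval, nilFrame, Fin.sum_univ_three]; ring

lemma frameEval_two : frameEval x 2 v = v 2 := by
  simp [frameEval, nilFrame, Fin.sum_univ_three]

variable {f : Fin 3 → (Fin 3 → ℝ) → ℝ}

lemma contDiff_frameEval (hf : ∀ i, ContDiff ℝ ∞ (f i)) (a : Fin 3) :
    ContDiff ℝ ∞ fun y => frameEval y a fun i => f i y := by
  have := hf 0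
  have := hf 1
  have := hf 2
  fin_cases a <;> simp only [Fin.zero_eta, Fin.mk_one, Fin.reduceFinMk, frameEval_zero,
    frameEval_one, frameEval_two] <;> fun_prop

/-- The last term comes from `∂₁ e₁ = -∂₃`; the frame has no other nonconstant component. -/
lemma pderiv_frameEval (hf : ∀ i, ContDiff ℝ ∞ (f i)) (k a : Fin 3) :
    pderiv k (fun y => frameEval y a fun i => f i y) x =
      frameEval x a (fun i => pderiv k (f i) x) - if k = 0 ∧ a = 1 then f 2 x else 0 := by
  have hd (i) : DifferentiableAt ℝ (f i) x := (hf i).differentiable (by simp) x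
  have h2 : pderiv k (fun y => f 1 y - y 0 * f 2 y) x =
      pderiv k (f 1) x - x 0 * pderiv k (f 2) x - if k = 0 then f 2 x else 0 := by
    rw [pderiv_sub _ (hd 1) (by fun_prop),
      pderiv_mul _ (by fun_prop) (hd 2), pderiv_coord]
    split_ifs <;> ring
  fin_cases a <;> simp [frameEval_zero, frameEval_one, frameEval_two, h2]

end FrameEval

/-- The derivative `e_c f` along a frame field. -/
def frameDeriv (c : Fin 3) (f : (Fin 3 → ℝ) → ℝ) (x : Fin 3 → ℝ) : ℝ :=
  frameEval x c fun k => pderiv k f x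

/-- The components `h(e_a, e_b)` of a 2-tensor field in the frame. -/
def toFrame (h : TwoTensor 3) (x : Fin 3 → ℝ) (a b : Fin 3) : ℝ :=
  frameEval x a fun i => frameEval x b fun j => h x i j

/-- The components `T(e_c, e_a, e_b)` of a 3-tensor field in the frame. -/
def toFrame₃ (T : ThreeTensor 3) (x : Fin 3 → ℝ) (c a b : Fin 3) : ℝ :=
  frameEval x c fun k => frameEval x a fun i => frameEval x b fun j => T x k i j

/-- The covariant derivative of a 2-tensor field in terms of its frame components `H`. -/
def frameCov (H : (Fin 3 → ℝ) → Fin 3 → Fin 3 → ℝ) (x : Fin 3 → ℝ) (c a b : Fin 3) : ℝ :=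
  frameDeriv c (fun y => H y a b) x - ∑ d, (nilConn c a d * H x d b + nilConn c b d * H x a d)

/-- The covariant derivative of a 3-tensor field in terms of its frame components `T`. -/
def frameCov₃ (T : (Fin 3 → ℝ) → Fin 3 → Fin 3 → Fin 3 → ℝ) (x : Fin 3 → ℝ)
    (e c a b : Fin 3) : ℝ :=
  frameDeriv e (fun y => T y c a b) x
    - ∑ d, (nilConn e c d * T x d a b + nilConn e a d * T x c d b + nilConn e b d * T x c a d)

/-- The tensor transformation law for `∇h`, checked component by component. -/
lemma toFrame₃_covDeriv {h : TwoTensor 3} (hh : ∀ i j, ContDiff ℝ ∞ fun x => h x i j)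
    (x : Fin 3 → ℝ) (c a b : Fin 3) :
    toFrame₃ (covDeriv nilMetric h) x c a b = frameCov (toFrame h) x c a b := by
  simp only [frameCov, frameDeriv]
  simp only [toFrame]
  simp only [pderiv_frameEval _ (fun i => contDiff_frameEval (fun j => hh i j) b) _ a,
    pderiv_frameEval _ (fun j => hh _ j) _ b]
  simp only [toFrame₃, covDeriv, christoffel_nil, Fin.sum_univ_three]
  fin_cases c <;> fin_cases a <;> fin_cases b <;>
    simp [frameEval_zero, frameEval_one, frameEval_two, nilChristoffel, nilConn] <;> try ring

/-! ### The operator in the frame -/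

set_option maxHeartbeats 1000000 in
/-- The transformation law for `∇T`; only the entries that enter the trace of the Laplacian are
needed. -/
lemma frameEval_covDeriv₃_diag {T : ThreeTensor 3} (hT : ∀ k i j, ContDiff ℝ ∞ fun x => T x k i j)
    (x : Fin 3 → ℝ) (c a b : Fin 3) :
    frameEval x c (fun l => frameEval x c fun k => frameEval x a fun i => frameEval x b fun j =>
      covDeriv₃ nilMetric T x l k i j) = frameCov₃ (toFrame₃ T) x c c a b := by
  simp only [frameCov₃, frameDeriv]
  simp only [toFrame₃]
  simp only [pderiv_frameEval _
      (fun k => contDiff_frameEval (fun i => contDiff_frameEval (fun j => hT k i j) b) a) _ c,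
    pderiv_frameEval _ (fun i => contDiff_frameEval (fun j => hT _ i j) b) _ a,
    pderiv_frameEval _ (fun j => hT _ _ j) _ b]
  simp only [covDeriv₃, christoffel_nil, Fin.sum_univ_three]
  fin_cases c <;> fin_cases a <;> fin_cases b <;>
    simp [frameEval_zero, frameEval_one, frameEval_two, nilChristoffel, nilConn] <;> try ring

lemma inner₂_nil (h k : TwoTensor 3) (x : Fin 3 → ℝ) :
    inner₂ nilMetric h k x = ∑ a, ∑ b, toFrame h x a b * toFrame k x a b := by
  simp only [inner₂, invMetric_nil, toFrame, Fin.sum_univ_three, frameEval_zero, frameEval_one,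
    frameEval_two]
  simp [nilFrame]
  ring

/-- The action `H ↦ R_acdb H_cd` of the curvature on 2-tensors, in frame components: the sectional
curvatures of the frame planes are `-3/4` for `e₀, e₁` and `1/4` for the two others. -/
def nilCurv (H : Fin 3 → Fin 3 → ℝ) (a b : Fin 3) : ℝ :=
  !![-3 / 4 * H 1 1 + 1 / 4 * H 2 2, 3 / 4 * H 1 0, -1 / 4 * H 2 0;
    3 / 4 * H 0 1, -3 / 4 * H 0 0 + 1 / 4 * H 2 2, -1 / 4 * H 2 1;
    -1 / 4 * H 0 2, -1 / 4 * H 1 2, 1 / 4 * H 0 0 + 1 / 4 * H 1 1] a b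

/-- The coordinate components of the 2-forms `θ¹ ∧ θ²`, `θ² ∧ θ⁰`, `θ⁰ ∧ θ¹`, where `θ^a` is row `a`
of `nilCoframe`. -/
def nilTwoForm (x : Fin 3 → ℝ) (s i j : Fin 3) : ℝ :=
  (![!![0, 0, 0; 0, 0, 1; 0, -1, 0],
     !![0, -x 0, -1; x 0, 0, 0; 1, 0, 0],
     !![0, 1, 0; -1, 0, 0; 0, 0, 0]] s) i j

set_option maxHeartbeats 1000000 in
/-- The curvature operator is diagonal on the 2-forms `nilTwoForm`. -/
lemma curvature_nil (x : Fin 3 → ℝ) (i j k l : Fin 3) :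
    curvature nilMetric x i j k l = -1 / 4 * (nilTwoForm x 0 i j * nilTwoForm x 0 k l)
      - 1 / 4 * (nilTwoForm x 1 i j * nilTwoForm x 1 k l)
      + 3 / 4 * (nilTwoForm x 2 i j * nilTwoForm x 2 k l) := by
  -- The derivatives go first: rewriting the symbols under `pderiv` would hide them.
  simp only [curvature, curvatureUp, pderiv_christoffel_nil]
  simp only [christoffel_nil, Fin.sum_univ_three, nilMetric]
  fin_cases i <;> fin_cases j <;> fin_cases k <;> fin_cases l <;>
    simp [nilChristoffel, nilChristoffelDeriv, nilCoframe, nilTwoForm] <;> try ring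

lemma raise_nil (h : TwoTensor 3) (x : Fin 3 → ℝ) (p q : Fin 3) :
    ∑ a, ∑ b, invMetric nilMetric x p a * invMetric nilMetric x q b * h x a b =
      ∑ c, ∑ d, nilFrame x p c * nilFrame x q d * toFrame h x c d := by
  simp only [invMetric_nil, toFrame, Fin.sum_univ_three, frameEval_zero, frameEval_one,
    frameEval_two]
  fin_cases p <;> fin_cases q <;> simp [nilFrame] <;> ring

lemma inner₃_nil (S T : ThreeTensor 3) (x : Fin 3 → ℝ) :
    inner₃ nilMetric S T x = ∑ c, ∑ a, ∑ b, toFrame₃ S x c a b * toFrame₃ T x c a b := by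
  have h1 : inner₃ nilMetric S T x = ∑ k, ∑ l, invMetric nilMetric x k l *
      ∑ a, ∑ b, toFrame (fun y => S y k) x a b * toFrame (fun y => T y l) x a b := by
    refine Finset.sum_congr rfl fun k _ => Finset.sum_congr rfl fun l _ => ?_
    rw [← inner₂_nil (fun y => S y k) (fun y => T y l) x]
    simp only [inner₂, Finset.mul_sum, mul_assoc]
  have h2 (S : ThreeTensor 3) : toFrame₃ S x = fun c a b =>
      ∑ k, nilFrame x k c * toFrame (fun y => S y k) x a b := rfl
  rw [h1, h2, h2]
  simp only [invMetric_nil]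
  simp only [Fin.sum_univ_three]
  simp [nilFrame]
  ring

lemma frameEval_curvature (h : TwoTensor 3) (x : Fin 3 → ℝ) (a b : Fin 3) :
    frameEval x a (fun i => frameEval x b fun j => ∑ p, ∑ q, curvature nilMetric x i p q j *
        (∑ a, ∑ b, invMetric nilMetric x p a * invMetric nilMetric x q b * h x a b)) =
      nilCurv (toFrame h x) a b := by
  simp only [raise_nil, curvature_nil]
  simp only [Fin.sum_univ_three]
  generalize toFrame h x = H
  fin_cases a <;> fin_cases b <;>
    simp [frameEval_zero, frameEval_one, frameEval_two, nilFrame, nilCurv, nilTwoForm] <;> try ring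

/-- The eigenvalues of the Ricci tensor in the frame. -/
def nilRicci : Fin 3 → ℝ := ![-1 / 2, -1 / 2, 1 / 2]

/-- The weights of the coframe under the dilations generated by `nilField`:
`ℒ_X θ^a = λ_a θ^a`. -/
def nilWeight : Fin 3 → ℝ := ![-1, -1, -2]

lemma ricci_nil (x : Fin 3 → ℝ) (j k : Fin 3) :
    ricci nilMetric x j k = ∑ a, nilRicci a * (nilCoframe x a j * nilCoframe x a k) := by
  simp only [ricci, curvature_nil, invMetric_nil]
  simp only [Fin.sum_univ_three]
  fin_cases j <;> fin_cases k <;>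
    simp [nilTwoForm, nilFrame, nilCoframe, nilRicci] <;> try ring

lemma ricci_raise_nil (x : Fin 3 → ℝ) (i k : Fin 3) :
    ∑ l, ricci nilMetric x i l * invMetric nilMetric x l k =
      ∑ a, nilRicci a * (nilCoframe x a i * nilFrame x k a) := by
  simp only [ricci_nil, invMetric_nil]
  simp only [Fin.sum_univ_three]
  fin_cases i <;> fin_cases k <;> simp [nilFrame, nilCoframe] <;> try ring

lemma frameEval_ricci_left (h : TwoTensor 3) (x : Fin 3 → ℝ) (a b : Fin 3) :
    frameEval x a (fun i => frameEval x b fun j =>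
      ∑ k, (∑ l, ricci nilMetric x i l * invMetric nilMetric x l k) * h x k j) =
      nilRicci a * toFrame h x a b := by
  simp only [ricci_raise_nil, toFrame]
  simp only [Fin.sum_univ_three]
  fin_cases a <;> fin_cases b <;>
    simp [frameEval_zero, frameEval_one, frameEval_two, nilFrame, nilCoframe] <;> try ring

lemma frameEval_ricci_right (h : TwoTensor 3) (x : Fin 3 → ℝ) (a b : Fin 3) :
    frameEval x a (fun i => frameEval x b fun j =>
      ∑ k, (∑ l, ricci nilMetric x j l * invMetric nilMetric x l k) * h x i k) =
      nilRicci b * toFrame h x a b := by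
  simp only [ricci_raise_nil, toFrame]
  simp only [Fin.sum_univ_three]
  fin_cases a <;> fin_cases b <;>
    simp [frameEval_zero, frameEval_one, frameEval_two, nilFrame, nilCoframe] <;> try ring

lemma pderiv_nilField (i k : Fin 3) (x : Fin 3 → ℝ) :
    pderiv i (fun y => nilField y k) x = if i = k then nilWeight k else 0 := by
  have key (c : ℝ) : pderiv i (fun y => c * y k) x = if i = k then c else 0 := by
    simpa using pderiv_comp_coord i k (((hasDerivAt_id (x k)).const_mul c))
  rw [← key]
  congr 1
  ext y
  fin_cases k <;> simp [nilField, nilWeight]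

lemma toFrame_lieDeriv {h : TwoTensor 3} (hh : ∀ i j, ContDiff ℝ ∞ fun x => h x i j)
    (x : Fin 3 → ℝ) (a b : Fin 3) :
    toFrame (lieDeriv nilField h) x a b =
      ∑ k, nilField x k * pderiv k (fun y => toFrame h y a b) x
        + (nilWeight a + nilWeight b) * toFrame h x a b := by
  simp only [toFrame]
  simp only [pderiv_frameEval _ (fun i => contDiff_frameEval (fun j => hh i j) b) _ a,
    pderiv_frameEval _ (fun j => hh _ j) _ b, lieDeriv, pderiv_nilField]
  simp only [Fin.sum_univ_three]
  fin_cases a <;> fin_cases b <;>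
    simp [frameEval_zero, frameEval_one, frameEval_two, nilField, nilWeight] <;> try ring

lemma toFrame_roughLaplacian {h : TwoTensor 3} (hh : ∀ i j, ContDiff ℝ ∞ fun x => h x i j)
    (x : Fin 3 → ℝ) (a b : Fin 3) :
    toFrame (roughLaplacian nilMetric h) x a b =
      ∑ c, frameCov₃ (frameCov (toFrame h)) x c c a b := by
  have hT : ∀ k i j, ContDiff ℝ ∞ fun x => covDeriv nilMetric h x k i j := by
    intro k i j
    have hk := contDiff_pderiv k (hh i j)
    have hΓ (m k i : Fin 3) : ContDiff ℝ ∞ (christoffel nilMetric m k i) := by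
      rw [christoffel_nil]
      fin_cases m <;> fin_cases k <;> fin_cases i <;> simp [nilChristoffel] <;> fun_prop
    simp only [covDeriv]
    fun_prop
  have hD : frameCov (toFrame h) = toFrame₃ (covDeriv nilMetric h) := by
    ext x c a b
    exact (toFrame₃_covDeriv hh x c a b).symm
  rw [hD]
  simp only [← frameEval_covDeriv₃_diag hT]
  simp only [toFrame, roughLaplacian, invMetric_nil]
  generalize covDeriv₃ nilMetric (covDeriv nilMetric h) x = T
  simp only [Fin.sum_univ_three]
  fin_cases a <;> fin_cases b <;>
    simp [frameEval_zero, frameEval_one, frameEval_two, nilFrame] <;> ring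

/-- All zero-order terms other than the curvature cancel: by the soliton equation, the Ricci
eigenvalue and the weight of `X` add up to `-3/2` on each frame vector. -/
lemma toFrame_nilL {h : TwoTensor 3} (hh : ∀ i j, ContDiff ℝ ∞ fun x => h x i j)
    (x : Fin 3 → ℝ) (a b : Fin 3) :
    toFrame (nilL h) x a b = ∑ c, frameCov₃ (frameCov (toFrame h)) x c c a b
      + 2 * nilCurv (toFrame h x) a b
      - ∑ k, nilField x k * pderiv k (fun y => toFrame h y a b) x := by
  have hadd (a : Fin 3) (v w : Fin 3 → ℝ) : frameEval x a (fun i => v i + w i) =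
      frameEval x a v + frameEval x a w := by
    simp [frameEval, mul_add, Finset.sum_add_distrib]
  have hsub (a : Fin 3) (v w : Fin 3 → ℝ) : frameEval x a (fun i => v i - w i) =
      frameEval x a v - frameEval x a w := by
    simp [frameEval, mul_sub]
  have hmul (a : Fin 3) (c : ℝ) (v : Fin 3 → ℝ) : frameEval x a (fun i => c * v i) =
      c * frameEval x a v := by
    simp [frameEval, Finset.mul_sum, mul_left_comm]
  have e1 := toFrame_roughLaplacian hh x a b
  have e2 := toFrame_lieDeriv hh x a b
  simp only [toFrame] at e1 e2
  rw [toFrame]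
  simp only [nilL, linearizedFlow, lichnerowicz, hsub, hadd, hmul, frameEval_curvature,
    frameEval_ricci_left, frameEval_ricci_right, e1, e2]
  have e3 : nilRicci a + nilWeight a = -3 / 2 := by
    fin_cases a <;> simp [nilRicci, nilWeight] <;> norm_num
  have e4 : nilRicci b + nilWeight b = -3 / 2 := by
    fin_cases b <;> simp [nilRicci, nilWeight] <;> norm_num
  simp only [toFrame]
  linear_combination -(frameEval x a fun i => frameEval x b fun j => h x i j) * (e3 + e4)

/-! ### Test functions -/

/-- Smooth compactly supported functions. -/
structure IsTestFunction {n : ℕ} (f : (Fin n → ℝ) → ℝ) : Prop where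
  smooth : ContDiff ℝ ∞ f
  compactSupport : HasCompactSupport f

namespace IsTestFunction

variable {n : ℕ} {f g : (Fin n → ℝ) → ℝ}

lemma add (hf : IsTestFunction f) (hg : IsTestFunction g) : IsTestFunction fun x => f x + g x :=
  ⟨hf.smooth.add hg.smooth, hf.compactSupport.add hg.compactSupport⟩

lemma smooth_mul (hf : ContDiff ℝ ∞ f) (hg : IsTestFunction g) :
    IsTestFunction fun x => f x * g x :=
  ⟨hf.mul hg.smooth, hg.compactSupport.mul_left⟩

lemma const_mul (c : ℝ) (hg : IsTestFunction g) : IsTestFunction fun x => c * g x :=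
  smooth_mul contDiff_const hg

lemma sub (hf : IsTestFunction f) (hg : IsTestFunction g) : IsTestFunction fun x => f x - g x := by
  simpa [sub_eq_add_neg] using hf.add (hg.const_mul (-1))

lemma sum {ι : Type*} (s : Finset ι) {F : ι → (Fin n → ℝ) → ℝ}
    (hF : ∀ a, IsTestFunction (F a)) : IsTestFunction fun x => ∑ a ∈ s, F a x := by
  classical
  induction s using Finset.induction_on with
  | empty => simpa using ⟨contDiff_const, HasCompactSupport.zero⟩
  | insert a s ha ih => simpa [Finset.sum_insert ha] using (hF a).add ih

lemma pderiv (hf : IsTestFunction f) (i : Fin n) : IsTestFunction (pderiv i f) :=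
  ⟨contDiff_pderiv i hf.smooth, hasCompactSupport_pderiv i hf.compactSupport⟩

lemma integrable (hf : IsTestFunction f) : Integrable f :=
  hf.smooth.continuous.integrable_of_hasCompactSupport hf.compactSupport

lemma memLp (hf : IsTestFunction f) : MemLp f 2 :=
  hf.smooth.continuous.memLp_of_hasCompactSupport hf.compactSupport

lemma differentiableAt (hf : IsTestFunction f) (x : Fin n → ℝ) : DifferentiableAt ℝ f x :=
  hf.smooth.differentiable (by simp) x

lemma integral_pderiv (hf : IsTestFunction f) (i : Fin n) : ∫ x, _root_.pderiv i f x = 0 :=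
  _root_.integral_pderiv i hf.smooth hf.compactSupport

end IsTestFunction

lemma contDiff_nilFrame (i a : Fin 3) : ContDiff ℝ ∞ fun x => nilFrame x i a := by
  fin_cases i <;> fin_cases a <;> simp [nilFrame] <;> fun_prop

lemma IsTestFunction.frameEval {f : Fin 3 → (Fin 3 → ℝ) → ℝ} (hf : ∀ i, IsTestFunction (f i))
    (a : Fin 3) : IsTestFunction fun x => frameEval x a fun i => f i x := by
  simp only [_root_.frameEval]
  exact .sum _ fun i => .smooth_mul (contDiff_nilFrame i a) (hf i)

lemma IsTestFunction.frameDeriv {f : (Fin 3 → ℝ) → ℝ} (hf : IsTestFunction f) (c : Fin 3) :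
    IsTestFunction (frameDeriv c f) :=
  .frameEval (fun k => hf.pderiv k) c

/-- The frame fields are divergence free. -/
lemma IsTestFunction.integral_frameDeriv {f : (Fin 3 → ℝ) → ℝ} (hf : IsTestFunction f)
    (c : Fin 3) : ∫ x, _root_.frameDeriv c f x = 0 := by
  have h1 : IsTestFunction fun x : Fin 3 → ℝ => x 0 * f x := .smooth_mul (by fun_prop) hf
  have h2 (x : Fin 3 → ℝ) : x 0 * _root_.pderiv 2 f x = _root_.pderiv 2 (fun x => x 0 * f x) x := by
    rw [pderiv_mul _ (by fun_prop) (hf.differentiableAt x)]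
    simp
  fin_cases c
  · simpa [_root_.frameDeriv, frameEval_zero] using hf.integral_pderiv 0
  · simp only [_root_.frameDeriv, Fin.mk_one, frameEval_one, h2]
    rw [integral_sub (hf.pderiv 1).integrable (h1.pderiv 2).integrable, hf.integral_pderiv,
      h1.integral_pderiv, sub_zero]
  · simpa [_root_.frameDeriv, frameEval_two] using hf.integral_pderiv 2

lemma IsTestTensor.apply {n : ℕ} {h : TwoTensor n} (hh : IsTestTensor h) (i j : Fin n) :
    IsTestFunction fun x => h x i j :=
  ⟨hh.smooth i j, hh.compactSupport.comp_left (g := fun M : Matrix (Fin n) (Fin n) ℝ => M i j) rfl⟩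

lemma IsTestTensor.toFrame {h : TwoTensor 3} (hh : IsTestTensor h) (a b : Fin 3) :
    IsTestFunction fun x => toFrame h x a b :=
  .frameEval (fun i => .frameEval (fun j => hh.apply i j) b) a

lemma IsTestFunction.frameCov {H : (Fin 3 → ℝ) → Fin 3 → Fin 3 → ℝ}
    (hH : ∀ a b, IsTestFunction fun x => H x a b) (c a b : Fin 3) :
    IsTestFunction fun x => frameCov H x c a b :=
  ((hH a b).frameDeriv c).sub <| .sum _ fun d => ((hH d b).const_mul _).add ((hH a d).const_mul _)

lemma IsTestFunction.frameCov₃ {T : (Fin 3 → ℝ) → Fin 3 → Fin 3 → Fin 3 → ℝ}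
    (hT : ∀ c a b, IsTestFunction fun x => T x c a b) (e c a b : Fin 3) :
    IsTestFunction fun x => frameCov₃ T x e c a b :=
  ((hT c a b).frameDeriv e).sub <| .sum _ fun d =>
    (((hT d a b).const_mul _).add ((hT c d b).const_mul _)).add ((hT c a d).const_mul _)

lemma contDiff_nilField (k : Fin 3) : ContDiff ℝ ∞ fun x => nilField x k := by
  fin_cases k <;> simp [nilField] <;> fun_prop

lemma IsTestTensor.toFrame_nilL {h : TwoTensor 3} (hh : IsTestTensor h) (a b : Fin 3) :
    IsTestFunction fun x => _root_.toFrame (nilL h) x a b := by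
  simp only [_root_.toFrame_nilL hh.smooth]
  have hH := hh.toFrame
  have hcurv : IsTestFunction fun x => nilCurv (_root_.toFrame h x) a b := by
    fin_cases a <;> fin_cases b <;> simp only [nilCurv, Fin.zero_eta, Fin.mk_one, Fin.reduceFinMk]
    exacts [((hH 1 1).const_mul _).add ((hH 2 2).const_mul _), (hH 1 0).const_mul _,
      (hH 2 0).const_mul _, (hH 0 1).const_mul _,
      ((hH 0 0).const_mul _).add ((hH 2 2).const_mul _), (hH 2 1).const_mul _,
      (hH 0 2).const_mul _, (hH 1 2).const_mul _,
      ((hH 0 0).const_mul _).add ((hH 1 1).const_mul _)]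
  exact ((IsTestFunction.sum _ fun c => .frameCov₃ (.frameCov hH) c c a b).add
    (hcurv.const_mul 2)).sub (.sum _ fun k => .smooth_mul (contDiff_nilField k) ((hH a b).pderiv k))

/-! ### The energy inequality -/

/-- The largest eigenvalue of the curvature on symmetric 2-tensors is `3/4`, attained on the
traceless tensors of the plane `e₀, e₁`. -/
lemma nilCurv_le (H : Fin 3 → Fin 3 → ℝ) :
    2 * ∑ a, ∑ b, nilCurv H a b * H a b ≤ 3 / 2 * ∑ a, ∑ b, H a b * H a b := by
  simp only [Fin.sum_univ_three]
  simp [nilCurv]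
  nlinarith [sq_nonneg (H 0 0 + H 1 1 - H 2 2 / 3), sq_nonneg (H 2 2), sq_nonneg (H 0 1 - H 1 0),
    sq_nonneg (H 0 2 + H 2 0), sq_nonneg (H 1 2 + H 2 1), sq_nonneg (H 0 2),
    sq_nonneg (H 2 0), sq_nonneg (H 1 2), sq_nonneg (H 2 1)]

lemma frameDeriv_mul {f g : (Fin 3 → ℝ) → ℝ} {x : Fin 3 → ℝ} (c : Fin 3)
    (hf : DifferentiableAt ℝ f x) (hg : DifferentiableAt ℝ g x) :
    frameDeriv c (fun y => f y * g y) x = frameDeriv c f x * g x + f x * frameDeriv c g x := by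
  simp only [frameDeriv, frameEval, pderiv_mul _ hf hg, Fin.sum_univ_three]
  ring

lemma frameDeriv_sum {ι : Type*} (s : Finset ι) {F : ι → (Fin 3 → ℝ) → ℝ} {x : Fin 3 → ℝ}
    (c : Fin 3) (hF : ∀ a ∈ s, DifferentiableAt ℝ (F a) x) :
    frameDeriv c (fun y => ∑ a ∈ s, F a y) x = ∑ a ∈ s, frameDeriv c (F a) x := by
  simp only [frameDeriv, frameEval, pderiv_sum s _ hF, Finset.mul_sum]
  exact Finset.sum_comm

/-- `⟨Δh, h⟩ = div ⟨∇h, h⟩ - |∇h|²` in the frame. The connection coefficients cancel because they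
are skew in the last two indices; the frame being divergence free, no zero-order term is left. -/
lemma frameLaplacian_mul_self {H : (Fin 3 → ℝ) → Fin 3 → Fin 3 → ℝ}
    (hH : ∀ a b, IsTestFunction fun x => H x a b) (x : Fin 3 → ℝ) :
    ∑ a, ∑ b, (∑ c, frameCov₃ (frameCov H) x c c a b) * H x a b =
      ∑ c, frameDeriv c (fun y => ∑ a, ∑ b, frameCov H y c a b * H y a b) x
        - ∑ c, ∑ a, ∑ b, frameCov H x c a b * frameCov H x c a b := by
  have hd (a b) : DifferentiableAt ℝ (fun x => H x a b) x := (hH a b).differentiableAt x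
  have hd' (c a b) : DifferentiableAt ℝ (fun x => frameCov H x c a b) x :=
    (IsTestFunction.frameCov hH c a b).differentiableAt x
  have h1 (c) : frameDeriv c (fun y => ∑ a, ∑ b, frameCov H y c a b * H y a b) x =
      ∑ a, ∑ b, (frameDeriv c (fun y => frameCov H y c a b) x * H x a b
        + frameCov H x c a b * frameDeriv c (fun y => H y a b) x) := by
    rw [frameDeriv_sum _ _ (by fun_prop)]
    refine Finset.sum_congr rfl fun a _ => ?_
    rw [frameDeriv_sum _ _ (by fun_prop)]
    exact Finset.sum_congr rfl fun b _ => frameDeriv_mul c (hd' c a b) (hd a b)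
  have h2 (c a b) : frameDeriv c (fun y => H y a b) x = frameCov H x c a b
      + ∑ d, (nilConn c a d * H x d b + nilConn c b d * H x a d) := by
    rw [frameCov]; ring
  simp only [h1, h2, frameCov₃]
  generalize (frameCov H x) = T
  generalize H x = K
  simp only [Fin.sum_univ_three]
  simp [nilConn]
  ring

/-- `⟨X h, h⟩ = ½ div (|h|² X) + 2 |h|²`, since `div X = -4`. -/
lemma nilField_mul_self {H : (Fin 3 → ℝ) → Fin 3 → Fin 3 → ℝ}
    (hH : ∀ a b, IsTestFunction fun x => H x a b) (x : Fin 3 → ℝ) :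
    ∑ a, ∑ b, (∑ k, nilField x k * pderiv k (fun y => H y a b) x) * H x a b =
      1 / 2 * ∑ k, pderiv k (fun y => nilField y k * ∑ a, ∑ b, H y a b * H y a b) x
        + 2 * ∑ a, ∑ b, H x a b * H x a b := by
  have hd (a b) : DifferentiableAt ℝ (fun x => H x a b) x := (hH a b).differentiableAt x
  have h1 (k) : pderiv k (fun y => ∑ a, ∑ b, H y a b * H y a b) x =
      ∑ a, ∑ b, (2 * (pderiv k (fun y => H y a b) x * H x a b)) := by
    rw [pderiv_sum _ _ (by fun_prop)]
    refine Finset.sum_congr rfl fun a _ => ?_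
    rw [pderiv_sum _ _ (by fun_prop)]
    refine Finset.sum_congr rfl fun b _ => ?_
    rw [pderiv_mul _ (hd a b) (hd a b)]
    ring
  have h2 (k) : pderiv k (fun y => nilField y k * ∑ a, ∑ b, H y a b * H y a b) x =
      nilWeight k * ∑ a, ∑ b, H x a b * H x a b + nilField x k *
        ∑ a, ∑ b, (2 * (pderiv k (fun y => H y a b) x * H x a b)) := by
    rw [pderiv_mul _ ((contDiff_nilField k).differentiable (by simp) x) (by fun_prop), h1,
      pderiv_nilField, if_pos rfl]
  simp only [h2]
  simp only [Fin.sum_univ_three]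
  simp [nilWeight]
  ring

lemma integral_inner_nilL_le {h : TwoTensor 3} (hh : IsTestTensor h) :
    ∫ x, inner₂ nilMetric (nilL h) h x ∂(riemVolume nilMetric) ≤
        -(∫ x, inner₃ nilMetric (covDeriv nilMetric h) (covDeriv nilMetric h) x
            ∂(riemVolume nilMetric))
          - 1 / 2 * normSq nilMetric h := by
  have hH := hh.toFrame
  have hD := IsTestFunction.frameCov hH
  simp only [normSq, riemVolume_nil, inner₂_nil, inner₃_nil, toFrame₃_covDeriv hh.smooth]
  set H := toFrame h with hHdef
  have i1 : IsTestFunction fun x => ∑ a, ∑ b, H x a b * H x a b :=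
    .sum _ fun a => .sum _ fun b => .smooth_mul (hH a b).smooth (hH a b)
  have i2 : IsTestFunction fun x => ∑ c, ∑ a, ∑ b, frameCov H x c a b * frameCov H x c a b :=
    .sum _ fun c => .sum _ fun a => .sum _ fun b => .smooth_mul (hD c a b).smooth (hD c a b)
  have i3 (c) : IsTestFunction fun x => ∑ a, ∑ b, frameCov H x c a b * H x a b :=
    .sum _ fun a => .sum _ fun b => .smooth_mul (hD c a b).smooth (hH a b)
  have i4 (k) : IsTestFunction fun x => nilField x k * ∑ a, ∑ b, H x a b * H x a b :=
    .smooth_mul (contDiff_nilField k) i1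
  have i5 : IsTestFunction fun x => ∑ a, ∑ b, toFrame (nilL h) x a b * H x a b :=
    .sum _ fun a => .sum _ fun b => .smooth_mul (hh.toFrame_nilL a b).smooth (hH a b)
  have i6 : IsTestFunction fun x =>
      ∑ c, frameDeriv c (fun y => ∑ a, ∑ b, frameCov H y c a b * H y a b) x :=
    .sum _ fun c => (i3 c).frameDeriv c
  have i7 : IsTestFunction fun x =>
      1 / 2 * ∑ k, pderiv k (fun y => nilField y k * ∑ a, ∑ b, H y a b * H y a b) x :=
    .const_mul _ (.sum _ fun k => (i4 k).pderiv k)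
  have z6 : ∫ x, ∑ c, frameDeriv c (fun y => ∑ a, ∑ b, frameCov H y c a b * H y a b) x = 0 := by
    rw [integral_finsetSum _ fun c _ => ((i3 c).frameDeriv c).integrable]
    exact Finset.sum_eq_zero fun c _ => (i3 c).integral_frameDeriv c
  have z7 : ∫ x, 1 / 2 * ∑ k, pderiv k (fun y => nilField y k * ∑ a, ∑ b, H y a b * H y a b) x
      = 0 := by
    rw [integral_const_mul, integral_finsetSum _ fun k _ => ((i4 k).pderiv k).integrable,
      Finset.sum_eq_zero fun k _ => (i4 k).integral_pderiv k, mul_zero]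
  have key (x) : ∑ a, ∑ b, toFrame (nilL h) x a b * H x a b ≤
      ∑ c, frameDeriv c (fun y => ∑ a, ∑ b, frameCov H y c a b * H y a b) x
        - 1 / 2 * ∑ k, pderiv k (fun y => nilField y k * ∑ a, ∑ b, H y a b * H y a b) x
        - ∑ c, ∑ a, ∑ b, frameCov H x c a b * frameCov H x c a b
        - 1 / 2 * ∑ a, ∑ b, H x a b * H x a b := by
    have e : ∑ a, ∑ b, toFrame (nilL h) x a b * H x a b =
        ∑ a, ∑ b, (∑ c, frameCov₃ (frameCov H) x c c a b) * H x a b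
          + 2 * ∑ a, ∑ b, nilCurv (H x) a b * H x a b
          - ∑ a, ∑ b, (∑ k, nilField x k * pderiv k (fun y => H y a b) x) * H x a b := by
      simp only [toFrame_nilL hh.smooth, ← hHdef, sub_mul, add_mul, Finset.sum_add_distrib,
        Finset.sum_sub_distrib, Finset.mul_sum, mul_assoc]
    rw [e, frameLaplacian_mul_self hH, nilField_mul_self hH]
    linarith [nilCurv_le (H x)]
  refine (integral_mono i5.integrable
    (((i6.sub i7).sub i2).sub (i1.const_mul (1 / 2))).integrable key).trans_eq ?_
  rw [integral_sub ((i6.sub i7).sub i2).integrable (i1.const_mul (1 / 2)).integrable,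
    integral_sub (i6.sub i7).integrable i2.integrable, integral_sub i6.integrable i7.integrable,
    z6, z7, integral_const_mul]
  ring

/-! ### Passage to the `L²` closure -/

section L2

variable {α : Type*} [MeasurableSpace α] {μ : Measure α}

lemma inner_toLp {f g : α → ℝ} (hf : MemLp f 2 μ) (hg : MemLp g 2 μ) :
    inner ℝ (hf.toLp f) (hg.toLp g) = ∫ x, f x * g x ∂μ := by
  rw [L2.inner_def]
  refine integral_congr_ae ?_
  filter_upwards [hf.coeFn_toLp, hg.coeFn_toLp] with x h1 h2
  simp [h1, h2, mul_comm]

lemma tendsto_toLp {f : ℕ → α → ℝ} {f₀ : α → ℝ} (hf : ∀ m, MemLp (f m) 2 μ)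
    (hf₀ : MemLp f₀ 2 μ)
    (h : Tendsto (fun m => ∫ x, (f m x - f₀ x) * (f m x - f₀ x) ∂μ) atTop (𝓝 0)) :
    Tendsto (fun m => (hf m).toLp (f m)) atTop (𝓝 (hf₀.toLp f₀)) := by
  rw [tendsto_iff_norm_sub_tendsto_zero]
  have e (m) : ‖(hf m).toLp (f m) - hf₀.toLp f₀‖ =
      Real.sqrt (∫ x, (f m x - f₀ x) * (f m x - f₀ x) ∂μ) := by
    rw [← MemLp.toLp_sub (hf m) hf₀, norm_eq_sqrt_real_inner, inner_toLp]
    rfl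
  simp only [e]
  simpa using h.sqrt

lemma tendsto_integral_mul {f g : ℕ → α → ℝ} {f₀ g₀ : α → ℝ} (hf : ∀ m, MemLp (f m) 2 μ)
    (hg : ∀ m, MemLp (g m) 2 μ) (hf₀ : MemLp f₀ 2 μ) (hg₀ : MemLp g₀ 2 μ)
    (h : Tendsto (fun m => ∫ x, (f m x - f₀ x) * (f m x - f₀ x) ∂μ) atTop (𝓝 0))
    (h' : Tendsto (fun m => ∫ x, (g m x - g₀ x) * (g m x - g₀ x) ∂μ) atTop (𝓝 0)) :
    Tendsto (fun m => ∫ x, f m x * g m x ∂μ) atTop (𝓝 (∫ x, f₀ x * g₀ x ∂μ)) := by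
  simpa only [inner_toLp] using (tendsto_toLp hf hf₀ h).inner (tendsto_toLp hg hg₀ h') (𝕜 := ℝ)

end L2

/-- A field all of whose frame components are square-integrable. -/
def HasL2Components (u : TwoTensor 3) : Prop := ∀ a b, MemLp (fun x => toFrame u x a b) 2

lemma toFrame_sub (h k : TwoTensor 3) (x : Fin 3 → ℝ) (a b : Fin 3) :
    toFrame (h - k) x a b = toFrame h x a b - toFrame k x a b := by
  simp [toFrame, frameEval, mul_sub]

lemma IsL2Tensor.hasL2Components {u : TwoTensor 3} (hu : IsL2Tensor nilMetric u) :
    HasL2Components u := by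
  intro a b
  have hm (i j) : AEStronglyMeasurable (fun x => u x i j) volume := by
    simpa only [riemVolume_nil] using hu.measurable i j
  have hF (a b) : AEStronglyMeasurable (fun x => toFrame u x a b) volume := by
    have hE (i a) : AEStronglyMeasurable (fun x => nilFrame x i a) volume :=
      (contDiff_nilFrame i a).continuous.aestronglyMeasurable
    simp only [toFrame, frameEval]
    fun_prop
  have hi := hu.integrable
  simp only [riemVolume_nil, funext (inner₂_nil u u)] at hi
  rw [memLp_two_iff_integrable_sq (hF a b)]
  refine hi.mono' ((hF a b).pow 2) (.of_forall fun x => ?_)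
  rw [Real.norm_of_nonneg (sq_nonneg _), sq]
  calc toFrame u x a b * toFrame u x a b ≤ ∑ b, toFrame u x a b * toFrame u x a b :=
        Finset.single_le_sum (f := fun b => toFrame u x a b * toFrame u x a b)
          (fun _ _ => mul_self_nonneg _) (Finset.mem_univ b)
    _ ≤ _ := Finset.single_le_sum (f := fun a => ∑ b, toFrame u x a b * toFrame u x a b)
          (fun _ _ => Finset.sum_nonneg fun _ _ => mul_self_nonneg _) (Finset.mem_univ a)

namespace HasL2Components

variable {h k : TwoTensor 3}

lemma sub (hh : HasL2Components h) (hk : HasL2Components k) : HasL2Components (h - k) := by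
  intro a b
  simp only [toFrame_sub]
  exact (hh a b).sub (hk a b)

lemma integral_inner₂ (hh : HasL2Components h) (hk : HasL2Components k) :
    ∫ x, inner₂ nilMetric h k x ∂(riemVolume nilMetric) =
      ∑ a, ∑ b, ∫ x, toFrame h x a b * toFrame k x a b := by
  have hi (a b) : Integrable fun x => toFrame h x a b * toFrame k x a b :=
    (hh a b).integrable_mul (hk a b)
  simp only [riemVolume_nil, inner₂_nil]
  rw [integral_finsetSum _ fun a _ => integrable_finsetSum _ fun b _ => hi a b]
  exact Finset.sum_congr rfl fun a _ => integral_finsetSum _ fun b _ => hi a b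

lemma normSq_eq (hh : HasL2Components h) :
    normSq nilMetric h = ∑ a, ∑ b, ∫ x, toFrame h x a b * toFrame h x a b :=
  hh.integral_inner₂ hh

lemma integral_le_normSq (hh : HasL2Components h) (a b : Fin 3) :
    ∫ x, toFrame h x a b * toFrame h x a b ≤ normSq nilMetric h := by
  have hn (a b) : 0 ≤ ∫ x, toFrame h x a b * toFrame h x a b :=
    integral_nonneg fun x => mul_self_nonneg _
  rw [hh.normSq_eq]
  exact (Finset.single_le_sum (f := fun b => ∫ x, toFrame h x a b * toFrame h x a b)
    (fun _ _ => hn _ _) (Finset.mem_univ b)).trans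
    (Finset.single_le_sum (f := fun a => ∑ b, ∫ x, toFrame h x a b * toFrame h x a b)
      (fun _ _ => Finset.sum_nonneg fun _ _ => hn _ _) (Finset.mem_univ a))

lemma tendsto_integral_inner₂ {h k : ℕ → TwoTensor 3} {h₀ k₀ : TwoTensor 3}
    (hh : ∀ m, HasL2Components (h m)) (hk : ∀ m, HasL2Components (k m))
    (hh₀ : HasL2Components h₀) (hk₀ : HasL2Components k₀)
    (lh : Tendsto (fun m => normSq nilMetric (h m - h₀)) atTop (𝓝 0))
    (lk : Tendsto (fun m => normSq nilMetric (k m - k₀)) atTop (𝓝 0)) :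
    Tendsto (fun m => ∫ x, inner₂ nilMetric (h m) (k m) x ∂(riemVolume nilMetric)) atTop
      (𝓝 (∫ x, inner₂ nilMetric h₀ k₀ x ∂(riemVolume nilMetric))) := by
  have comp {h : ℕ → TwoTensor 3} {h₀ : TwoTensor 3} (hh : ∀ m, HasL2Components (h m))
      (hh₀ : HasL2Components h₀)
      (lh : Tendsto (fun m => normSq nilMetric (h m - h₀)) atTop (𝓝 0)) (a b : Fin 3) :
      Tendsto (fun m => ∫ x, (toFrame (h m) x a b - toFrame h₀ x a b) *
        (toFrame (h m) x a b - toFrame h₀ x a b)) atTop (𝓝 0) := by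
    refine squeeze_zero (fun m => integral_nonneg fun x => mul_self_nonneg _) (fun m => ?_) lh
    simpa only [toFrame_sub] using ((hh m).sub hh₀).integral_le_normSq a b
  simp only [fun m => (hh m).integral_inner₂ (hk m), hh₀.integral_inner₂ hk₀]
  exact tendsto_finsetSum _ fun a _ => tendsto_finsetSum _ fun b _ =>
    tendsto_integral_mul (fun m => hh m a b) (fun m => hk m a b) (hh₀ a b) (hk₀ a b)
      (comp hh hh₀ lh a b) (comp hk hk₀ lk a b)

end HasL2Components

lemma IsTestTensor.hasL2Components {h : TwoTensor 3} (hh : IsTestTensor h) : HasL2Components h :=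
  fun a b => (hh.toFrame a b).memLp

lemma IsTestTensor.hasL2Components_nilL {h : TwoTensor 3} (hh : IsTestTensor h) :
    HasL2Components (nilL h) :=
  fun a b => (hh.toFrame_nilL a b).memLp

/-- The 2-tensor field with frame components `K`. -/
def ofFrame (K : (Fin 3 → ℝ) → Fin 3 → Fin 3 → ℝ) : TwoTensor 3 := fun x i j =>
  ∑ a, ∑ b, nilCoframe x a i * nilCoframe x b j * K x a b

lemma toFrame_ofFrame (K : (Fin 3 → ℝ) → Fin 3 → Fin 3 → ℝ) : toFrame (ofFrame K) = K := by
  ext x a b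
  simp only [toFrame, ofFrame]
  simp only [Fin.sum_univ_three]
  fin_cases a <;> fin_cases b <;>
    (simp [frameEval_zero, frameEval_one, frameEval_two, nilCoframe]; try ring)

lemma contDiff_nilCoframe (a i : Fin 3) : ContDiff ℝ ∞ fun x => nilCoframe x a i := by
  fin_cases a <;> fin_cases i <;> simp [nilCoframe] <;> fun_prop

lemma isTestTensor_ofFrame {K : (Fin 3 → ℝ) → Fin 3 → Fin 3 → ℝ}
    (hK : ∀ a b, IsTestFunction fun x => K x a b) (hs : ∀ x a b, K x a b = K x b a) :
    IsTestTensor (ofFrame K) where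
  smooth i j := by
    have hθ := contDiff_nilCoframe
    have hK' a b := (hK a b).smooth
    simp only [ofFrame]
    fun_prop
  compactSupport := by
    refine HasCompactSupport.of_support_subset_isCompact
      (isCompact_iUnion fun p : Fin 3 × Fin 3 => (hK p.1 p.2).compactSupport) fun x hx => ?_
    by_contra hn
    simp only [Set.mem_iUnion, not_exists] at hn
    refine hx ?_
    ext i j
    have h0 (a b) : K x a b = 0 :=
      image_eq_zero_of_notMem_tsupport (f := fun x => K x a b) (hn (a, b))
    simp [ofFrame, h0]
  symm x i j := by
    simp only [ofFrame]
    rw [Finset.sum_comm]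
    refine Finset.sum_congr rfl fun a _ => Finset.sum_congr rfl fun b _ => ?_
    rw [hs x b a]
    ring

lemma exists_isTestFunction_integral_sq_le {n : ℕ} {f : (Fin n → ℝ) → ℝ} (hf : MemLp f 2) {ε : ℝ}
    (hε : 0 < ε) : ∃ g, IsTestFunction g ∧ ∫ x, (g x - f x) * (g x - f x) ≤ ε := by
  obtain ⟨g, hc, hs, hg⟩ := hf.exist_eLpNorm_sub_le (by simp) (by norm_num) (Real.sqrt_pos.2 hε)
  have hg' : IsTestFunction g := ⟨hs, hc⟩
  refine ⟨g, hg', ?_⟩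
  have hd : MemLp (f - g) 2 := hf.sub hg'.memLp
  have h1 : ‖hd.toLp‖ ≤ Real.sqrt ε := by
    rw [Lp.norm_toLp]
    exact ENNReal.toReal_le_of_le_ofReal (Real.sqrt_nonneg _) hg
  have h2 : ‖hd.toLp‖ ^ 2 = ∫ x, (g x - f x) * (g x - f x) := by
    rw [← real_inner_self_eq_norm_sq, inner_toLp]
    refine integral_congr_ae (.of_forall fun x => ?_)
    simp only [Pi.sub_apply]
    ring
  rw [← h2, ← Real.sq_sqrt hε.le]
  gcongr

lemma exists_isTestTensor_normSq_lt {u : TwoTensor 3} (hu : IsL2Tensor nilMetric u) {ε : ℝ}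
    (hε : 0 < ε) : ∃ h, IsTestTensor h ∧ normSq nilMetric (h - u) < ε := by
  have hU := hu.hasL2Components
  choose G hG hGle using fun a b =>
    exists_isTestFunction_integral_sq_le (hU a b) (show 0 < ε / 18 by positivity)
  -- Using only the approximants with `a ≤ b` keeps the field exactly symmetric.
  set K : (Fin 3 → ℝ) → Fin 3 → Fin 3 → ℝ := fun x a b => G (min a b) (max a b) x
  have hK : IsTestTensor (ofFrame K) :=
    isTestTensor_ofFrame (fun a b => hG _ _) fun x a b => by simp only [K, min_comm, max_comm]
  refine ⟨ofFrame K, hK, ?_⟩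
  have hsymm : ∀ᵐ x, ∀ a b, toFrame u x a b = toFrame u x (min a b) (max a b) := by
    have hs := hu.symm
    rw [riemVolume_nil] at hs
    filter_upwards [hs] with x hx a b
    have h1 (a b) : toFrame u x a b = toFrame u x b a := by
      simp only [toFrame, frameEval, Finset.mul_sum]
      rw [Finset.sum_comm]
      refine Finset.sum_congr rfl fun i _ => Finset.sum_congr rfl fun j _ => ?_
      rw [hx j i]
      ring
    rcases le_total a b with h | h
    · rw [min_eq_left h, max_eq_right h]
    · rw [min_eq_right h, max_eq_left h, h1]
  have hle (a b) : ∫ x, toFrame (ofFrame K - u) x a b * toFrame (ofFrame K - u) x a b ≤ ε / 18 := by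
    refine le_of_eq_of_le (integral_congr_ae ?_) (hGle (min a b) (max a b))
    filter_upwards [hsymm] with x hx
    rw [toFrame_sub, toFrame_ofFrame, hx a b]
  rw [(hK.hasL2Components.sub hU).normSq_eq]
  calc _ ≤ ∑ _a : Fin 3, ∑ _b : Fin 3, ε / 18 :=
        Finset.sum_le_sum fun a _ => Finset.sum_le_sum fun b _ => hle a b
    _ < ε := by simp; linarith

theorem proposition4p1 :
    (∀ h : TwoTensor 3, IsTestTensor h →
      ∫ x, inner₂ nilMetric (nilL h) h x ∂(riemVolume nilMetric) ≤
        -(∫ x, inner₃ nilMetric (covDeriv nilMetric h) (covDeriv nilMetric h) x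
            ∂(riemVolume nilMetric))
          - 1 / 2 * normSq nilMetric h) ∧
    StrictlyLinearlyStable nilMetric nilL (1 / 2) := by
  refine ⟨fun h hh => integral_inner_nilL_le hh, by norm_num,
    fun u hu ε hε => exists_isTestTensor_normSq_lt hu hε, ?_⟩
  rintro u f ⟨hu, hf, h, hh, hhu, hLf⟩
  have hU := hu.hasL2Components
  have hF := hf.hasL2Components
  have hH m := (hh m).hasL2Components
  have hL m := (hh m).hasL2Components_nilL
  refine le_of_tendsto_of_tendsto'
    (HasL2Components.tendsto_integral_inner₂ hL hH hF hU hLf hhu)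
    ((HasL2Components.tendsto_integral_inner₂ hH hH hU hU hhu hhu).const_mul (-(1 / 2)))
    fun m => ?_
  have hD : 0 ≤ ∫ x, inner₃ nilMetric (covDeriv nilMetric (h m)) (covDeriv nilMetric (h m)) x
      ∂(riemVolume nilMetric) := by
    refine integral_nonneg fun x => ?_
    simp only [inner₃_nil]
    exact Finset.sum_nonneg fun _ _ => Finset.sum_nonneg fun _ _ => Finset.sum_nonneg fun _ _ =>
      mul_self_nonneg _
  have := integral_inner_nilL_le (hh m)
  rw [normSq] at this
  linarith

end
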